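/- Let $c_i$ ($i\in\mathcal E$) and $c_j$ ($j\in\mathcal I$) be finitely many polynomials in $\mathbb R[x]=\mathbb R[x_1,\dots,x_n]$, let $K=\{x\in\mathbb R^n: c_i(x)=0\ (i\in\mathcal E),\ c_j(x)\ge 0\ (j\in\mathcal I)\}$, and let $g\in\mathbb R[x]$ have degree $d$. Put $d_1=\lceil d/2\rceil$. For a polynomial $p$, let $p^{hom}$ be its homogeneous part of degree $\deg p$ and $\tilde p(x_0,x)=x_0^{\deg p}\,p(x/x_0)$ its homogenization. Define $$\widetilde K=\{(x_0,x)\in\mathbb R^{n+1}:\ \tilde c_i(x_0,x)=0\ (i\in\mathcal E),\ \tilde c_j(x_0,x)\ge0\ (j\in\mathcal I),\ x_0^2+x^Tx=1,\ x_0\ge 0\},$$ $$K^\circ=\{x\in\mathbb R^n:\ c_i^{hom}(x)=0\ (i\in\mathcal E),\ c_j^{hom}(x)\ge0\ (j\in\mathcal I),\ x^Tx=1\}.$$ For $D\ge 0$ let $[x]_D$ be the vector of all monomials $x^\alpha$ with $|\alpha|\le D$, let $\langle p,z\rangle=\sum_{|\alpha|\le D}p_\alpha z_\alpha$ for $p=\sum_\alpha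 p_\alpha x^\alpha$ of degree at most $D$ and $z=(z_\alpha)_{|\alpha|\le D}$, and let $\mathscr R_D(K^\circ)$ be the set of all vectors $\int [x]_D\,d\mu$, where $\mu$ is a Borel measure on $\mathbb R^n$ with support contained in $K^\circ$ whose moments up to degree $D$ exist. Let $\Sigma[x]_{2d_1}$ be the cone of sums of squares of degree at most $2d_1$, and take its interior in the space of polynomials of degree at most $2d_1$. A property holds for generic $R$ in this interior if it holds for all $R$ in it except those whose coefficient vectors lie in some set of Lebesgue measure zero. Consider the ray system $$(1)\qquad \langle g^{hom},z\rangle=-1,\quad z\in\mathscr R_d(K^\circ).$$ (i) Suppose that (1) is feasible. Then, for generic $R$ in the interior of $\Sigma[x]_{2d_1}$, the problem of minimizing $\langle R,z\rangle$ subject to $\langle g^{hom},z\rangle=-1$, $z\in\mathscr R_{2d_1}(K^\circ)$, has a unique optimizer $z^*$, and $z^*=\lambda[u]_{2d_1}$ for some $u\in K^\circ$ and $\lambda>0$. (ii) Suppose that $d\ge 1$ and that $z=\lambda[u]_d$, with $u\in K^\circ$ and $\lambda>0$, is feasible for (1). If $(0,u)$ lies in the closure of $\widetilde K\cap\{x_0>0\}$,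 then $g$ is unbounded below on $K$, i.e. there is a sequence $(x_k)$ in $K$ with $g(x_k)\to-\infty$. -/

import Mathlib

open MeasureTheory Filter Topology

namespace MomentUnbounded

noncomputable section

/-- The index set `ℕⁿ_d` of exponents `α ∈ ℕⁿ` with `|α| ≤ d`. -/
abbrev Expo (n d : ℕ) : Type := {α : Fin n →₀ ℕ // α.degree ≤ d}

instance instFintypeExpo (n d : ℕ) : Fintype (Expo n d) :=
  (Finsupp.finite_of_degree_le (σ := Fin n) d).fintype

/-- Real vectors labeled by `ℕⁿ_d`: truncated multi-sequences of degree `d`, and also coefficient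
vectors of polynomials of degree at most `d`. It carries the Euclidean topology and the Lebesgue
measure `volume`. -/
abbrev TMS (n d : ℕ) : Type := Expo n d → ℝ

/-- The vector `[u]_d` of all monomials of degree at most `d`, evaluated at `u`. -/
def monoVec {n : ℕ} (d : ℕ) (u : Fin n → ℝ) : TMS n d :=
  fun α => ∏ i, u i ^ α.1 i

/-- The coefficient vector of a polynomial, up to degree `d`. -/
def coeffVec {n : ℕ} (d : ℕ) (p : MvPolynomial (Fin n) ℝ) : TMS n d :=
  fun α => p.coeff α.1

/-- The pairing `⟨p, z⟩ = ∑ p_α z_α` for `deg p ≤ d` and a truncated multi-sequence `z` of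
degree `d`. -/
def pairing {n d : ℕ} (p : MvPolynomial (Fin n) ℝ) (z : TMS n d) : ℝ :=
  ∑ α : Expo n d, p.coeff α.1 * z α

/-- The moment cone `R_d(K)`: all `y = ∫ [x]_d dμ` with `μ` a Borel measure supported in `K`
all of whose moments up to degree `d` exist (so `μ` is finite, by the moment of degree `0`). -/
def momentCone {n : ℕ} (d : ℕ) (K : Set (Fin n → ℝ)) : Set (TMS n d) :=
  {y | ∃ μ : Measure (Fin n → ℝ), μ.support ⊆ K ∧
    (∀ α : Expo n d, Integrable (fun x => monoVec d x α) μ) ∧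
    ∀ α : Expo n d, y α = ∫ x, monoVec d x α ∂μ}

/-- The part `p^hom` of highest degree of `p`. -/
def topForm {n : ℕ} (p : MvPolynomial (Fin n) ℝ) : MvPolynomial (Fin n) ℝ :=
  MvPolynomial.homogeneousComponent p.totalDegree p

/-- The homogenization `x₀ ^ deg p * p (x / x₀)` of `p`; the variable `x₀` has index `0`, and `x_i`
becomes the variable with index `i.succ`. -/
def homogenization {n : ℕ} (p : MvPolynomial (Fin n) ℝ) : MvPolynomial (Fin (n + 1)) ℝ :=
  ∑ α ∈ p.support, MvPolynomial.monomial (Finsupp.cons (p.totalDegree - α.degree) α) (p.coeff α)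

section Sets

variable {n : ℕ} {ι : Type*} (E I : Finset ι) (c : ι → MvPolynomial (Fin n) ℝ)

/-- The feasible set `K`. -/
def feasibleSet : Set (Fin n → ℝ) :=
  {x | (∀ i ∈ E, (c i).eval x = 0) ∧ ∀ j ∈ I, 0 ≤ (c j).eval x}

/-- The homogenized set `K̃` in the unit sphere of `ℝ^(n+1)`. -/
def homogenizedSet : Set (Fin (n + 1) → ℝ) :=
  {y | (∀ i ∈ E, (homogenization (c i)).eval y = 0) ∧ ∑ k, y k ^ 2 = 1 ∧
    (∀ j ∈ I, 0 ≤ (homogenization (c j)).eval y) ∧ 0 ≤ y 0}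

/-- The set `K°` in the unit sphere of `ℝⁿ`. -/
def infinitySet : Set (Fin n → ℝ) :=
  {x | (∀ i ∈ E, (topForm (c i)).eval x = 0) ∧ ∑ k, x k ^ 2 = 1 ∧
    ∀ j ∈ I, 0 ≤ (topForm (c j)).eval x}

/-- The solutions of degree `D` of `⟨g^hom, z⟩ = -1`, `z ∈ R_D(K°)`. -/
def raySystem (g : MvPolynomial (Fin n) ℝ) (D : ℕ) : Set (TMS n D) :=
  {z | pairing (topForm g) z = -1 ∧ z ∈ momentCone D (infinitySet E I c)}

/-- `z` is an optimizer of: minimize `⟨R, z⟩` over the solutions of degree `D` of the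
ray system. -/
def IsRayOptimizer (g : MvPolynomial (Fin n) ℝ) (D : ℕ) (R : MvPolynomial (Fin n) ℝ)
    (z : TMS n D) : Prop :=
  z ∈ raySystem E I c g D ∧ ∀ w ∈ raySystem E I c g D, pairing R z ≤ pairing R w

end Sets

/-- `Σ[x]_D`: the sums of squares of degree at most `D`. -/
def sosCone (n D : ℕ) : Set (MvPolynomial (Fin n) ℝ) :=
  {σ | IsSumSq σ ∧ σ.totalDegree ≤ D}

/-- The interior of `Σ[x]_D` in the space of polynomials of degree at most `D`, whose Euclidean
topology is read off the coefficients. -/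
def sosInterior (n D : ℕ) : Set (MvPolynomial (Fin n) ℝ) :=
  {R | R.totalDegree ≤ D ∧ coeffVec D R ∈ interior (coeffVec D '' sosCone n D)}

/-- A property holds for generic `R` in a set `S` of polynomials of degree at most `D`, if it holds
for all `R ∈ S` except those whose coefficient vectors lie in some Lebesgue null set. -/
def ForGeneric {n : ℕ} (D : ℕ) (S : Set (MvPolynomial (Fin n) ℝ))
    (P : MvPolynomial (Fin n) ℝ → Prop) : Prop :=
  ∃ N : Set (TMS n D), volume N = 0 ∧ ∀ R ∈ S, coeffVec D R ∉ N → P R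

/-- Minimizing `g` over `K` is unbounded below: `g → -∞` along some sequence in `K`. -/
def UnboundedBelowOn {n : ℕ} (g : MvPolynomial (Fin n) ℝ) (K : Set (Fin n → ℝ)) : Prop :=
  ∃ x : ℕ → Fin n → ℝ, (∀ k, x k ∈ K) ∧ Tendsto (fun k => g.eval (x k)) atTop atBot

end

end MomentUnbounded

open MomentUnbounded

namespace MomentUnbounded

/-! ### Almost every linear functional has at most one minimizer -/

section GenericUniqueness

variable {ι : Type*} [Fintype ι]

/-! (i) Subtracting a small constant from an interior sum of squares `R` leaves a sum of squares, so
`R > 0` everywhere. Feasibility makes `g^hom` negative somewhere on the compact set `K°`, so `-g^hom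
/ R` has a maximum `M > 0` there, at some `u`. Integrating `-g^hom ≤ M R` against a measure on `K°`
gives `⟨R, z⟩ ≥ 1 / M` for each feasible `z`, with equality at a multiple of `[u]`
(`exists_rankOne_minimizer`). Uniqueness needs only `R` generic: every minimizer is a gradient of
the infimum as a function of `R`, and by Rademacher's theorem this function, on bounded pieces of
the feasible set, is differentiable almost everywhere (`ae_unique_minimizer`).

(ii) For `x₀ > 0`, `g (x / x₀)` is `x₀ ^ (-d)` times the homogenization of `g` at `(x₀, x)`. As
`(x₀, x)` tends to `(0, u)` the second factor tends to `g^hom(u) < 0` and the first to infinity. -/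

theorem abs_dotProduct_le_card_mul (r z : ι → ℝ) :
    |r ⬝ᵥ z| ≤ Fintype.card ι * ‖z‖ * ‖r‖ := by
  calc |r ⬝ᵥ z| ≤ ∑ i, |r i * z i| := Finset.abs_sum_le_sum_abs _ _
    _ ≤ ∑ _i : ι, ‖z‖ * ‖r‖ := by
        refine Finset.sum_le_sum fun i _ => ?_
        rw [abs_mul, mul_comm]
        exact mul_le_mul (norm_le_pi_norm z i) (norm_le_pi_norm r i) (abs_nonneg _)
          (norm_nonneg _)
    _ = _ := by simp [mul_assoc]

/-- The value function `r ↦ inf ⟨r, z⟩` over a bounded set of `z`. -/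
noncomputable def valueFun (S : Set (ι → ℝ)) (r : ι → ℝ) : ℝ := ⨅ z : S, r ⬝ᵥ (z : ι → ℝ)

theorem bddBelow_range_dotProduct {S : Set (ι → ℝ)} {k : ℝ} (hS : ∀ z ∈ S, ‖z‖ ≤ k)
    (r : ι → ℝ) : BddBelow (Set.range fun z : S => r ⬝ᵥ (z : ι → ℝ)) := by
  refine ⟨-(Fintype.card ι * k * ‖r‖), ?_⟩
  rintro _ ⟨z, rfl⟩
  have h := neg_le_of_abs_le (abs_dotProduct_le_card_mul r z.1)
  have h2 : Fintype.card ι * ‖z.1‖ * ‖r‖ ≤ Fintype.card ι * k * ‖r‖ := by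
    gcongr
    exact hS z.1 z.2
  simp only
  linarith

theorem lipschitzWith_valueFun {S : Set (ι → ℝ)} {k : NNReal} (hS : ∀ z ∈ S, ‖z‖ ≤ k) :
    LipschitzWith (Fintype.card ι * k) (valueFun S) := by
  refine LipschitzWith.of_le_add_mul _ fun r s => ?_
  -- Over the empty set the real infimum is `0` by default, so the value function is constant.
  rcases S.eq_empty_or_nonempty with rfl | hne
  · simp only [valueFun, Real.iInf_of_isEmpty, zero_add]
    positivity
  have := hne.to_subtype
  rw [← sub_le_iff_le_add]
  refine le_ciInf fun z => ?_
  have h1 : valueFun S r ≤ r ⬝ᵥ z.1 := ciInf_le (bddBelow_range_dotProduct hS r) z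
  have h2 : (r - s) ⬝ᵥ z.1 ≤ _ := (le_abs_self _).trans (abs_dotProduct_le_card_mul (r - s) z.1)
  have h3 : Fintype.card ι * ‖z.1‖ * ‖r - s‖ ≤ Fintype.card ι * k * ‖r - s‖ := by
    gcongr
    exact hS z.1 z.2
  rw [sub_dotProduct] at h2
  push_cast
  rw [dist_eq_norm]
  linarith

/-- A differentiable function has at most one linear majorant touching it at a given point. -/
theorem eq_of_touching_linear_majorants {V : (ι → ℝ) → ℝ} {r z w : ι → ℝ}
    (hV : DifferentiableAt ℝ V r) (hz : ∀ s, V s ≤ s ⬝ᵥ z) (hzr : V r = r ⬝ᵥ z)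
    (hw : ∀ s, V s ≤ s ⬝ᵥ w) (hwr : V r = r ⬝ᵥ w) : z = w := by
  have key : ∀ v : ι → ℝ, (∀ s, V s ≤ s ⬝ᵥ v) → V r = r ⬝ᵥ v → ∀ s, fderiv ℝ V r s = s ⬝ᵥ v := by
    intro v hv hvr s
    let L : (ι → ℝ) →L[ℝ] ℝ := LinearMap.toContinuousLinearMap
      { toFun := fun s => s ⬝ᵥ v
        map_add' := fun a b => add_dotProduct a b v
        map_smul' := fun a b => smul_dotProduct a b v }
    -- The majorant minus `V` is least at the touching point, so the two derivatives agree there.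
    have hmin : IsLocalMin (fun s => L s - V s) r := Filter.Eventually.of_forall fun s => by
      change r ⬝ᵥ v - V r ≤ s ⬝ᵥ v - V s
      linarith [hv s]
    have h0 := hmin.hasFDerivAt_eq_zero (L.hasFDerivAt.sub hV.hasFDerivAt)
    have h1 := DFunLike.congr_fun h0 s
    change s ⬝ᵥ v - fderiv ℝ V r s = 0 at h1
    linarith
  classical
  ext i
  have h := (key z hz hzr (Pi.single i 1)).symm.trans (key w hw hwr (Pi.single i 1))
  simpa using h

/-- Over an arbitrary set, almost every linear functional has at most one minimizer. -/
theorem ae_unique_minimizer (S : Set (ι → ℝ)) :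
    ∀ᵐ r : ι → ℝ, ∀ z ∈ S, ∀ w ∈ S, (∀ v ∈ S, r ⬝ᵥ z ≤ r ⬝ᵥ v) →
      (∀ v ∈ S, r ⬝ᵥ w ≤ r ⬝ᵥ v) → z = w := by
  -- `S` may be unbounded. Countably many bounded pieces suffice, since any two minimizers lie in a
  -- common one.
  let T : ℕ → Set (ι → ℝ) := fun k => {z ∈ S | ‖z‖ ≤ k}
  have hT : ∀ k, ∀ z ∈ T k, ‖z‖ ≤ (k : NNReal) := fun k z hz => by simpa using hz.2
  have hdiff : ∀ᵐ r : ι → ℝ, ∀ k, DifferentiableAt ℝ (valueFun (T k)) r :=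
    ae_all_iff.2 fun k => (lipschitzWith_valueFun (hT k)).ae_differentiableAt
  filter_upwards [hdiff] with r hr z hz w hw hzmin hwmin
  obtain ⟨k, hk⟩ := exists_nat_ge (max ‖z‖ ‖w‖)
  have hzk : z ∈ T k := ⟨hz, (le_max_left _ _).trans hk⟩
  have hwk : w ∈ T k := ⟨hw, (le_max_right _ _).trans hk⟩
  have hle : ∀ v ∈ T k, ∀ s, valueFun (T k) s ≤ s ⬝ᵥ v := fun v hv s =>
    ciInf_le (bddBelow_range_dotProduct (hT k) s) ⟨v, hv⟩
  have hge : ∀ v, (∀ v' ∈ S, r ⬝ᵥ v ≤ r ⬝ᵥ v') → r ⬝ᵥ v ≤ valueFun (T k) r := fun v hv => by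
    have : Nonempty (T k) := ⟨⟨z, hzk⟩⟩
    exact le_ciInf fun v' => hv v'.1 v'.2.1
  exact eq_of_touching_linear_majorants (hr k) (hle z hzk) (le_antisymm (hle z hzk r) (hge z hzmin))
    (hle w hwk) (le_antisymm (hle w hwk r) (hge w hwmin))

end GenericUniqueness

/-! ### Pairing with polynomials as evaluation and integration -/

section Pairing

variable {n : ℕ}

theorem degree_le_totalDegree {p : MvPolynomial (Fin n) ℝ} {α : Fin n →₀ ℕ}
    (h : α ∈ p.support) : α.degree ≤ p.totalDegree :=
  MvPolynomial.le_totalDegree h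

theorem eval_eq_sum_expo {D : ℕ} {p : MvPolynomial (Fin n) ℝ} (hp : p.totalDegree ≤ D)
    (u : Fin n → ℝ) : p.eval u = ∑ α : Expo n D, p.coeff α.1 * monoVec D u α := by
  classical
  rw [MvPolynomial.eval_eq']
  have h := Finset.sum_subtype (F := instFintypeExpo n D)
    ((Finsupp.finite_of_degree_le (σ := Fin n) D).toFinset) (by simp)
    (fun α => p.coeff α * ∏ i, u i ^ α i)
  refine Eq.trans ?_ (h.trans ?_)
  · refine Finset.sum_subset (fun α hα => ?_) fun α _ hα => ?_
    · simpa using (degree_le_totalDegree hα).trans hp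
    · rw [MvPolynomial.notMem_support_iff.1 hα, zero_mul]
  · rfl

theorem pairing_monoVec {D : ℕ} {p : MvPolynomial (Fin n) ℝ} (hp : p.totalDegree ≤ D)
    (u : Fin n → ℝ) : pairing p (monoVec D u) = p.eval u :=
  (eval_eq_sum_expo hp u).symm

theorem pairing_smul {D : ℕ} (p : MvPolynomial (Fin n) ℝ) (l : ℝ) (z : TMS n D) :
    pairing p (l • z) = l * pairing p z := by
  simp only [pairing, Finset.mul_sum, Pi.smul_apply, smul_eq_mul]
  exact Finset.sum_congr rfl fun _ _ => by ring

theorem pairing_eq_integral {D : ℕ} {p : MvPolynomial (Fin n) ℝ} (hp : p.totalDegree ≤ D)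
    {μ : Measure (Fin n → ℝ)} (hμ : ∀ α : Expo n D, Integrable (fun x => monoVec D x α) μ)
    {z : TMS n D} (hz : ∀ α, z α = ∫ x, monoVec D x α ∂μ) :
    pairing p z = ∫ x, p.eval x ∂μ := by
  simp_rw [eval_eq_sum_expo hp, pairing, hz]
  rw [integral_finsetSum _ fun α _ => (hμ α).const_mul _]
  simp_rw [integral_const_mul]

theorem integrable_eval {D : ℕ} {p : MvPolynomial (Fin n) ℝ} (hp : p.totalDegree ≤ D)
    {μ : Measure (Fin n → ℝ)} (hμ : ∀ α : Expo n D, Integrable (fun x => monoVec D x α) μ) :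
    Integrable (fun x => p.eval x) μ := by
  simp_rw [eval_eq_sum_expo hp]
  exact integrable_finsetSum _ fun α _ => (hμ α).const_mul _

theorem isHomogeneous_topForm (p : MvPolynomial (Fin n) ℝ) :
    (topForm p).IsHomogeneous p.totalDegree :=
  MvPolynomial.homogeneousComponent_isHomogeneous _ _

theorem totalDegree_topForm_le (p : MvPolynomial (Fin n) ℝ) :
    (topForm p).totalDegree ≤ p.totalDegree :=
  (isHomogeneous_topForm p).totalDegree_le

end Pairing

/-! ### Moment vectors and rank-one minimizers -/

section MomentCone

variable {n : ℕ}

theorem ae_mem_of_support_subset {K : Set (Fin n → ℝ)} {μ : Measure (Fin n → ℝ)}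
    (hμ : μ.support ⊆ K) : ∀ᵐ x ∂μ, x ∈ K :=
  Filter.mem_of_superset Measure.support_mem_ae hμ

theorem smul_monoVec_mem_momentCone {D : ℕ} {K : Set (Fin n → ℝ)} {u : Fin n → ℝ} (hu : u ∈ K)
    {l : ℝ} (hl : 0 ≤ l) : l • monoVec D u ∈ momentCone D K := by
  have hfin : IsFiniteMeasure (ENNReal.ofReal l • Measure.dirac u) :=
    Measure.smul_finite _ ENNReal.ofReal_ne_top
  refine ⟨ENNReal.ofReal l • Measure.dirac u, ?_, fun α => ?_, fun α => ?_⟩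
  · refine (Measure.support_subset_of_isClosed (t := {u}) isClosed_singleton ?_).trans
      (Set.singleton_subset_iff.2 hu)
    rw [mem_ae_iff]
    simp
  · exact (integrable_dirac (by simp)).smul_measure ENNReal.ofReal_ne_top
  · rw [integral_smul_measure, integral_dirac, ENNReal.toReal_ofReal hl]
    rfl

theorem isFiniteMeasure_of_integrable_monoVec {D : ℕ} {μ : Measure (Fin n → ℝ)}
    (hμ : ∀ α : Expo n D, Integrable (fun x => monoVec D x α) μ) : IsFiniteMeasure μ := by
  have h := hμ ⟨0, by simp⟩
  simpa [monoVec, integrable_const_iff] using h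

theorem exists_momentCone_of_isCompact {d : ℕ} (D : ℕ) {K : Set (Fin n → ℝ)} (hK : IsCompact K)
    {y : TMS n d} (hy : y ∈ momentCone d K) :
    ∃ z ∈ momentCone D K, ∀ p : MvPolynomial (Fin n) ℝ, p.totalDegree ≤ d → p.totalDegree ≤ D →
      pairing p z = pairing p y := by
  obtain ⟨μ, hsupp, hint, hyμ⟩ := hy
  have := isFiniteMeasure_of_integrable_monoVec hint
  have hint' : ∀ α : Expo n D, Integrable (fun x => monoVec D x α) μ := fun α => by
    have hc : Continuous fun x : Fin n → ℝ => monoVec D x α := by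
      unfold monoVec
      fun_prop
    obtain ⟨C, hC⟩ := hK.exists_bound_of_continuousOn hc.continuousOn
    exact Integrable.of_bound hc.aestronglyMeasurable C
      ((ae_mem_of_support_subset hsupp).mono hC)
  refine ⟨fun α => ∫ x, monoVec D x α ∂μ, ⟨μ, hsupp, hint', fun _ => rfl⟩, fun p h₁ h₂ => ?_⟩
  rw [pairing_eq_integral h₂ hint' fun _ => rfl, pairing_eq_integral h₁ hint hyμ]

/-- Otherwise the pairing would be the integral of a function that is nonnegative almost everywhere.
-/
theorem exists_eval_neg_of_pairing_neg {d : ℕ} {K : Set (Fin n → ℝ)} {y : TMS n d}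
    (hy : y ∈ momentCone d K) {p : MvPolynomial (Fin n) ℝ} (hp : p.totalDegree ≤ d)
    (h : pairing p y < 0) : ∃ u ∈ K, p.eval u < 0 := by
  obtain ⟨μ, hsupp, hint, hyμ⟩ := hy
  by_contra! hcon
  rw [pairing_eq_integral hp hint hyμ] at h
  exact h.not_ge (integral_nonneg_of_ae ((ae_mem_of_support_subset hsupp).mono hcon))

/-- If `r > 0` on the compact set `K`, then minimizing `⟨r, z⟩` over the moment vectors on `K` with
`⟨h, z⟩ = -1` is solved by a multiple of a single vector of monomials. -/
theorem exists_rankOne_minimizer {D : ℕ} {K : Set (Fin n → ℝ)} (hK : IsCompact K)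
    {h r : MvPolynomial (Fin n) ℝ} (hh : h.totalDegree ≤ D) (hr : r.totalDegree ≤ D)
    (hpos : ∀ u ∈ K, 0 < r.eval u) (hneg : ∃ u ∈ K, h.eval u < 0) :
    ∃ u ∈ K, ∃ l : ℝ, 0 < l ∧ pairing h (l • monoVec D u) = -1 ∧
      ∀ w ∈ momentCone D K, pairing h w = -1 → pairing r (l • monoVec D u) ≤ pairing r w := by
  obtain ⟨v, hvK, hv⟩ := hneg
  have hcont : ContinuousOn (fun u => -h.eval u / r.eval u) K := by
    refine ContinuousOn.div ?_ ?_ fun u hu => (hpos u hu).ne'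
    · exact (MvPolynomial.continuous_eval h).neg.continuousOn
    · exact (MvPolynomial.continuous_eval r).continuousOn
  obtain ⟨u, huK, hu⟩ := hK.exists_isMaxOn ⟨v, hvK⟩ hcont
  have hru := hpos u huK
  have hM : 0 < -h.eval u / r.eval u :=
    (div_pos (neg_pos.2 hv) (hpos v hvK)).trans_le (hu hvK)
  have hhu : 0 < -h.eval u := by
    have := mul_pos hM hru
    rwa [div_mul_cancel₀ _ hru.ne'] at this
  -- This multiple normalizes the pairing with `h` to `-1`.
  refine ⟨u, huK, (-h.eval u)⁻¹, inv_pos.2 hhu, ?_, ?_⟩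
  · rw [pairing_smul, pairing_monoVec hh]
    field_simp [neg_pos.1 hhu |>.ne]
  · rintro w ⟨μ, hsupp, hint, hw⟩ hwh
    rw [pairing_eq_integral hh hint hw] at hwh
    rw [pairing_smul, pairing_monoVec hr, pairing_eq_integral hr hint hw]
    have hle : ∫ x, -h.eval x ∂μ ≤ ∫ x, (-h.eval u / r.eval u) * r.eval x ∂μ := by
      refine integral_mono_ae (integrable_eval hh hint).neg
        ((integrable_eval hr hint).const_mul _) ?_
      filter_upwards [ae_mem_of_support_subset hsupp] with x hx
      have hxle : -h.eval x / r.eval x ≤ -h.eval u / r.eval u := hu hx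
      exact (div_le_iff₀ (hpos x hx)).1 hxle
    rw [integral_neg, hwh, integral_const_mul, neg_neg] at hle
    rw [← div_le_iff₀' hM, one_div, inv_div] at hle
    rwa [← div_eq_inv_mul]

end MomentCone

/-! ### Positivity of interior sums of squares -/

section Positivity

variable {n : ℕ}

/-- For small `t > 0` the polynomial `R - t` is still a sum of squares, whence `R ≥ t`. -/
theorem eval_pos_of_mem_sosInterior {D : ℕ} {R : MvPolynomial (Fin n) ℝ}
    (hR : R ∈ sosInterior n D) (u : Fin n → ℝ) : 0 < R.eval u := by
  obtain ⟨hdeg, hint⟩ := hR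
  have hcont : Tendsto (fun t : ℝ => coeffVec D R - t • coeffVec D (1 : MvPolynomial (Fin n) ℝ))
      (𝓝[>] 0) (𝓝 (coeffVec D R)) := by
    have : Continuous fun t : ℝ =>
        coeffVec D R - t • coeffVec D (1 : MvPolynomial (Fin n) ℝ) := by fun_prop
    simpa using (this.tendsto 0).mono_left nhdsWithin_le_nhds
  obtain ⟨t, ht, ht0⟩ := ((hcont.eventually (mem_interior_iff_mem_nhds.1 hint)).and
    self_mem_nhdsWithin).exists
  obtain ⟨σ, ⟨hσ, hσdeg⟩, hσt⟩ := ht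
  have hσu : 0 ≤ σ.eval u := by
    clear hσt hσdeg
    induction hσ with
    | zero => simp
    | sq_add a _ ih =>
      rw [map_add, map_mul]
      exact add_nonneg (mul_self_nonneg _) ih
  have h1 : R.eval u = σ.eval u + t * (1 : MvPolynomial (Fin n) ℝ).eval u := by
    rw [eval_eq_sum_expo hdeg, eval_eq_sum_expo hσdeg,
      eval_eq_sum_expo (D := D) (p := 1) (by simp), Finset.mul_sum, ← Finset.sum_add_distrib]
    refine Finset.sum_congr rfl fun α _ => ?_
    have := congrFun hσt α
    simp only [coeffVec, Pi.sub_apply, Pi.smul_apply, smul_eq_mul] at this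
    rw [this]
    ring
  rw [h1, map_one, mul_one]
  exact add_pos_of_nonneg_of_pos hσu ht0

end Positivity

/-! ### Compactness of `K°` -/

section Infinity

variable {n : ℕ} {ι : Type*} (E I : Finset ι) (c : ι → MvPolynomial (Fin n) ℝ)

theorem isCompact_infinitySet : IsCompact (infinitySet E I c) := by
  refine Metric.isCompact_of_isClosed_isBounded ?_ ?_
  · have : infinitySet E I c = (⋂ i ∈ E, {x | (topForm (c i)).eval x = 0}) ∩
        ({x | ∑ k, x k ^ 2 = 1} ∩ ⋂ j ∈ I, {x | 0 ≤ (topForm (c j)).eval x}) := by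
      ext x
      simp [infinitySet]
    rw [this]
    refine (isClosed_biInter fun i _ => ?_).inter (IsClosed.inter ?_
      (isClosed_biInter fun j _ => ?_))
    · exact isClosed_eq (MvPolynomial.continuous_eval _) continuous_const
    · exact isClosed_eq (by fun_prop) continuous_const
    · exact isClosed_le continuous_const (MvPolynomial.continuous_eval _)
  · refine (Metric.isBounded_closedBall (x := (0 : Fin n → ℝ)) (r := 1)).subset fun x hx => ?_
    rw [mem_closedBall_zero_iff, pi_norm_le_iff_of_nonneg zero_le_one]
    intro i
    rw [Real.norm_eq_abs, ← sq_le_one_iff_abs_le_one, ← hx.2.1]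
    exact Finset.single_le_sum (f := fun k => x k ^ 2) (fun k _ => sq_nonneg _) (Finset.mem_univ i)

end Infinity

/-! ### Homogenization and escape to infinity -/

section Homogenization

variable {n : ℕ}

theorem eval_homogenization (p : MvPolynomial (Fin n) ℝ) (y : Fin (n + 1) → ℝ) :
    (homogenization p).eval y =
      ∑ α ∈ p.support, p.coeff α * (y 0 ^ (p.totalDegree - α.degree) *
        ∏ i : Fin n, y i.succ ^ α i) := by
  rw [homogenization, map_sum]
  refine Finset.sum_congr rfl fun α _ => ?_
  rw [MvPolynomial.eval_monomial, Finsupp.prod_fintype _ _ (by simp), Fin.prod_univ_succ]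
  simp

theorem eval_homogenization_of_ne_zero (p : MvPolynomial (Fin n) ℝ) {y : Fin (n + 1) → ℝ}
    (hy : y 0 ≠ 0) :
    (homogenization p).eval y = y 0 ^ p.totalDegree * p.eval (fun i => y i.succ / y 0) := by
  rw [eval_homogenization, MvPolynomial.eval_eq', Finset.mul_sum]
  refine Finset.sum_congr rfl fun α hα => ?_
  simp_rw [div_pow]
  rw [Finset.prod_div_distrib, Finset.prod_pow_eq_pow_sum, ← Finsupp.degree_eq_sum,
    pow_sub₀ _ hy (degree_le_totalDegree hα)]
  ring

theorem eval_homogenization_cons_zero (p : MvPolynomial (Fin n) ℝ) (u : Fin n → ℝ) :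
    (homogenization p).eval (Fin.cons 0 u : Fin (n + 1) → ℝ) = (topForm p).eval u := by
  rw [eval_homogenization, topForm, MvPolynomial.homogeneousComponent_apply, map_sum,
    Finset.sum_filter]
  refine Finset.sum_congr rfl fun α hα => ?_
  split_ifs with h
  · rw [MvPolynomial.eval_monomial, Finsupp.prod_fintype _ _ (by simp)]
    simp [h]
  · have := degree_le_totalDegree hα
    -- A monomial below top degree carries a positive power of `x₀ = 0`.
    rw [Fin.cons_zero, zero_pow (by omega), zero_mul, mul_zero]

theorem dehomogenize_mem_feasibleSet {ι : Type*} {E I : Finset ι}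
    {c : ι → MvPolynomial (Fin n) ℝ} {y : Fin (n + 1) → ℝ} (hy : y ∈ homogenizedSet E I c)
    (hy0 : 0 < y 0) : (fun i : Fin n => y i.succ / y 0) ∈ feasibleSet E I c := by
  refine ⟨fun i hi => ?_, fun j hj => ?_⟩
  · have := hy.1 i hi
    rw [eval_homogenization_of_ne_zero _ hy0.ne'] at this
    exact (mul_eq_zero.1 this).resolve_left (pow_pos hy0 _).ne'
  · have := hy.2.2.1 j hj
    rw [eval_homogenization_of_ne_zero _ hy0.ne'] at this
    exact nonneg_of_mul_nonneg_right this (pow_pos hy0 _)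

theorem unboundedBelowOn_of_topForm_neg {ι : Type*} {E I : Finset ι}
    {c : ι → MvPolynomial (Fin n) ℝ} {g : MvPolynomial (Fin n) ℝ} (hg : 1 ≤ g.totalDegree)
    {u : Fin n → ℝ} (hu : (topForm g).eval u < 0)
    (hcl : (Fin.cons 0 u : Fin (n + 1) → ℝ) ∈ closure (homogenizedSet E I c ∩ {y | 0 < y 0})) :
    UnboundedBelowOn g (feasibleSet E I c) := by
  obtain ⟨y, hy, hlim⟩ := mem_closure_iff_seq_limit.1 hcl
  refine ⟨fun k i => y k i.succ / y k 0,
    fun k => dehomogenize_mem_feasibleSet (hy k).1 (hy k).2, ?_⟩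
  have h0 : Tendsto (fun k => y k 0 ^ g.totalDegree) atTop (𝓝[>] 0) := by
    refine tendsto_nhdsWithin_iff.2 ⟨?_, .of_forall fun k => Set.mem_Ioi.2 (pow_pos (hy k).2 _)⟩
    have := ((tendsto_pi_nhds.1 hlim 0).pow g.totalDegree)
    -- The limit is `0` because the degree of `g` is at least `1`.
    rwa [Fin.cons_zero, zero_pow (by omega)] at this
  have h1 : Tendsto (fun k => (homogenization g).eval (y k)) atTop (𝓝 ((topForm g).eval u)) := by
    rw [← eval_homogenization_cons_zero]
    exact ((MvPolynomial.continuous_eval _).tendsto _).comp hlim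
  refine (h0.inv_tendsto_nhdsGT_zero.atTop_mul_neg hu h1).congr fun k => ?_
  rw [Pi.inv_apply, eval_homogenization_of_ne_zero _ (hy k).2.ne',
    inv_mul_cancel_left₀ (pow_pos (hy k).2 _).ne']

end Homogenization

end MomentUnbounded

theorem theorem4p1 {n : ℕ} {ι : Type*} (E I : Finset ι) (c : ι → MvPolynomial (Fin n) ℝ)
    (g : MvPolynomial (Fin n) ℝ) (d d₁ : ℕ) (hd : d = g.totalDegree)
    (hd₁ : d₁ = ⌈(d : ℝ) / 2⌉₊) :
    ((raySystem E I c g d).Nonempty →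
      ForGeneric (2 * d₁) (sosInterior n (2 * d₁)) fun R =>
        ∃ z : TMS n (2 * d₁), IsRayOptimizer E I c g (2 * d₁) R z ∧
          (∀ w, IsRayOptimizer E I c g (2 * d₁) R w → w = z) ∧
          ∃ u ∈ infinitySet E I c, ∃ l : ℝ, 0 < l ∧ z = l • monoVec (2 * d₁) u) ∧
    (1 ≤ d → ∀ u ∈ infinitySet E I c, ∀ l : ℝ, 0 < l →
      l • monoVec d u ∈ raySystem E I c g d →
      (Fin.cons 0 u : Fin (n + 1) → ℝ) ∈ closure (homogenizedSet E I c ∩ {y | 0 < y 0}) →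
      UnboundedBelowOn g (feasibleSet E I c)) := by
  subst hd
  have hd₁' : g.totalDegree ≤ 2 * d₁ := by
    have h : (g.totalDegree : ℝ) / 2 ≤ d₁ := hd₁ ▸ Nat.le_ceil _
    rw [div_le_iff₀ two_pos] at h
    exact_mod_cast h.trans_eq (mul_comm _ _)
  have htop := totalDegree_topForm_le g
  have htop' := htop.trans hd₁'
  refine ⟨?_, ?_⟩
  · rintro ⟨y, hy, hyK⟩
    have hneg := exists_eval_neg_of_pairing_neg hyK htop (by rw [hy]; norm_num)
    -- The exceptional null set consists of the coefficient vectors for which uniqueness fails;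
    -- pairing with `R` is the dot product with its coefficient vector.
    refine ⟨_, ae_unique_minimizer (raySystem E I c g (2 * d₁)), fun R hR hRN => ?_⟩
    obtain ⟨u, hu, l, hl, hul, hmin⟩ := exists_rankOne_minimizer (isCompact_infinitySet E I c)
      htop' hR.1 (fun u _ => eval_pos_of_mem_sosInterior hR u) hneg
    have hopt : IsRayOptimizer E I c g (2 * d₁) R (l • monoVec (2 * d₁) u) :=
      ⟨⟨hul, smul_monoVec_mem_momentCone hu hl.le⟩, fun w hw => hmin w hw.2 hw.1⟩
    refine ⟨_, hopt, fun w hw => ?_, u, hu, l, hl, rfl⟩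
    exact not_not.1 hRN w hw.1 _ hopt.1 hw.2 hopt.2
  · intro hd u _ l hl hz hcl
    have h := hz.1
    rw [pairing_smul, pairing_monoVec htop] at h
    exact unboundedBelowOn_of_topForm_neg hd
      (neg_of_mul_neg_right (h.trans_lt (by norm_num)) hl.le) hcl
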